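/- \textbf{Theorem (Capacity Scaling of the NDFHL Channel).} Let $d\ge 2$ be an integer, $p=d-1$, $\lambda>0$ and $u>0$. Let $\mathrm{NDFHL}^{(d)}(\lambda,u)$ be the distribution on $\mathbb{R}^{p}$ with density \[ f_{\mathbf N}(\mathbf n)=\frac{\lambda}{2^{\frac d2-1}\pi^{\frac d2}}\left(\frac{u}{\rho(\mathbf n)}\right)^{\frac d2}e^{\lambda u}K_{\frac d2}\bigl(u\,\rho(\mathbf n)\bigr),\qquad \rho(\mathbf n)=\sqrt{\|\mathbf n\|^2+\lambda^2}, \] where $K_\nu$ is the modified Bessel function of the second kind; this is a probability density. Consider the additive noise channel $\mathbf Y=\mathbf X+\mathbf N$ with $\mathbf N\sim\mathrm{NDFHL}^{(d)}(\lambda,u)$ independent of the input $\mathbf X\in\mathbb{R}^p$, and let \[ C(P)=\sup_{P_{\mathbf X}:\ \mathbb E\|\mathbf X\|^2\le P} I(\mathbf X;\mathbf X+\mathbf N) \] be its capacity (in nats) under the average power constraint $P$. Then $C(P)$ is finite for all sufficiently large $P$, and, with $d,\lambda,u$ fixed, \[ C(P)=\frac p2\log P+O(1)\qquad\text{as }P\to\infty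 . \] In particular the pre-log factor $\lim_{P\to\infty} C(P)/\log P$ equals $p/2$, where $p=d-1$ is the dimension of the receiving boundary. -/

import Mathlib

open MeasureTheory Filter Topology Asymptotics
open scoped ENNReal

/-- The modified Bessel function of the second kind `K_ν(z)`, for `z > 0`, through its standard
integral representation `K_ν(z) = ∫₀^∞ exp(-z cosh t) cosh(ν t) dt`. -/
noncomputable def besselK (ν z : ℝ) : ℝ :=
  ∫ t in Set.Ioi (0 : ℝ), Real.exp (-z * Real.cosh t) * Real.cosh (ν * t)

/-- The Euclidean distance `ρ(n) = √(‖n‖² + lam²)` from the release point to the location `n` on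
the hyperplane at distance `lam`. -/
noncomputable def hyperplaneDist {p : ℕ} (lam : ℝ) (n : EuclideanSpace ℝ (Fin p)) : ℝ :=
  Real.sqrt (‖n‖ ^ 2 + lam ^ 2)

/-- The probability density function of the normally-drifted first-hitting location distribution
`NDFHL^(d)(lam, u)` on `ℝ^(d-1)`. -/
noncomputable def ndfhlPDF (d : ℕ) (lam u : ℝ) (n : EuclideanSpace ℝ (Fin (d - 1))) : ℝ :=
  lam / ((2 : ℝ) ^ ((d : ℝ) / 2 - 1) * Real.pi ^ ((d : ℝ) / 2))
    * (u / hyperplaneDist lam n) ^ ((d : ℝ) / 2)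
    * Real.exp (lam * u) * besselK ((d : ℝ) / 2) (u * hyperplaneDist lam n)

/-- The distribution `NDFHL^(d)(lam, u)`: the measure on `ℝ^(d-1)` with density `ndfhlPDF d lam u`
with respect to Lebesgue measure. -/
noncomputable def ndfhl (d : ℕ) (lam u : ℝ) : Measure (EuclideanSpace ℝ (Fin (d - 1))) :=
  volume.withDensity fun n => ENNReal.ofReal (ndfhlPDF d lam u n)

/-- The mutual information `I(X; Y)` (in nats) of a pair `(X, Y)` with joint law `γ`: the
Kullback–Leibler divergence of `γ` from the product of its marginals. -/
noncomputable def mutualInfo {α β : Type*} [MeasurableSpace α] [MeasurableSpace β]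
    (γ : Measure (α × β)) : ℝ≥0∞ :=
  InformationTheory.klDiv γ (γ.fst.prod γ.snd)

/-- The joint law of input and output `(X, X + N)` of the additive noise channel, for independent
`X ∼ μ` and `N ∼ ν`. -/
noncomputable def additiveChannelLaw {p : ℕ} (ν μ : Measure (EuclideanSpace ℝ (Fin p))) :
    Measure (EuclideanSpace ℝ (Fin p) × EuclideanSpace ℝ (Fin p)) :=
  (μ.prod ν).map fun z => (z.1, z.1 + z.2)

/-- The capacity `C(P)` of the channel `Y = X + N` with noise law `ν`: the supremum of `I(X; X + N)`
over all input laws `μ` with `𝔼‖X‖² ≤ P`. -/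
noncomputable def channelCapacity {p : ℕ} (ν : Measure (EuclideanSpace ℝ (Fin p))) (P : ℝ) :
    ℝ≥0∞ :=
  ⨆ μ ∈ {μ : Measure (EuclideanSpace ℝ (Fin p)) |
      IsProbabilityMeasure μ ∧ ∫⁻ x, ‖x‖ₑ ^ 2 ∂μ ≤ ENNReal.ofReal P},
    mutualInfo (additiveChannelLaw ν μ)

/-!
The noise density `f` of `NDFHL^(d)(lam, u)` is a Gaussian mixture: shifting the variable in the
integral for `K_{d/2}` by `log ρ(n)` gives (`ndfhlPDF_eq`)
`f(n) = A ∫ exp (-(u / 2) (e^τ + (‖n‖² + lam²) e^{-τ}) - (d / 2) τ) dτ`.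
By Tonelli's theorem, integrating out the Gaussian variable `n` reduces the total mass to `K_{1/2}`,
which is elementary, so `f` is a probability density (`isProbabilityMeasure_ndfhl`). In the same way
the second moment is finite (`integrable_norm_sq_ndfhl`). Moreover `f` is bounded (`ndfhlPDF_le`)
and `log f` is bounded below by a quadratic polynomial in `‖n‖` (`le_log_ndfhlPDF`).

These properties determine the capacity up to a bounded error. If `f_Y` denotes the output density,
the log-likelihood ratio of the joint law to the product of its marginals is
`log f(y - x) - log f_Y(y)` (`llr_additiveChannelLaw`).

* Upper bound (`channelCapacity_le`): `log f ≤ log M`, and for a Gaussian density `q` of variance of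
  order `P` one has `-log f_Y ≤ q / f_Y - 1 - log q`. Here `q / f_Y` has mean `1`, while `-log q` is
  `(p / 2) log P` plus a term whose mean is bounded because `𝔼‖Y‖² = O(P)`.
* Lower bound (`le_channelCapacity`): for an input uniform on the ball of radius `√P`, the output
  density is at most the inverse of the volume of that ball, which is a constant times `P^(-p/2)`,
  and `𝔼 log f(N)` is finite.

All bounds on the log-likelihood ratio are pointwise and integrable, and a one-sided bound of this
kind already controls the divergence (`klDiv_le_ofReal_integral`, `ofReal_integral_le_klDiv`); no
entropy has to be shown finite beforehand.
-/

/-! ### Bounds for the Kullback–Leibler divergence -/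

section KullbackLeibler

open InformationTheory

variable {α : Type*} [MeasurableSpace α] {μ ν : Measure α}
  [IsProbabilityMeasure μ] [IsProbabilityMeasure ν]

/-- The negative part of the log-likelihood ratio is always integrable, since
`r * max (-log r) 0 ≤ 1` for the density `r`. Hence a one-sided bound suffices. -/
theorem integrable_llr_of_ae_le (hμν : μ ≪ ν) {g : α → ℝ} (hg : Integrable g μ)
    (h : ∀ᵐ x ∂μ, llr μ ν x ≤ g x) : Integrable (llr μ ν) μ := by
  have hneg : Integrable (fun x => max (-llr μ ν x) 0) μ := by
    rw [← integrable_rnDeriv_smul_iff hμν]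
    refine Integrable.mono' (integrable_const (1 : ℝ)) ?_ (ae_of_all _ fun x => ?_)
    · exact ((Measure.measurable_rnDeriv μ ν).ennreal_toReal.smul
        ((measurable_llr μ ν).neg.max measurable_const)).aestronglyMeasurable
    · set r := (μ.rnDeriv ν x).toReal with hr
      have hr0 : 0 ≤ r := ENNReal.toReal_nonneg
      simp only [llr, ← hr, smul_eq_mul]
      rw [Real.norm_of_nonneg (by positivity), mul_max_of_nonneg _ _ hr0]
      refine max_le ?_ (by simp)
      rcases hr0.eq_or_lt with h0 | h0
      · simp [← h0]
      · have := Real.log_le_sub_one_of_pos (inv_pos.2 h0)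
        rw [Real.log_inv] at this
        calc r * -Real.log r ≤ r * (r⁻¹ - 1) := by gcongr
          _ = 1 - r := by field_simp
          _ ≤ 1 := by linarith
  refine Integrable.mono' (hg.abs.add hneg) (measurable_llr μ ν).aestronglyMeasurable ?_
  filter_upwards [h] with x hx
  simp only [Real.norm_eq_abs, Pi.add_apply]
  refine abs_le.2 ⟨?_, ?_⟩
  · have := le_max_left (-llr μ ν x) 0
    have := abs_nonneg (g x)
    linarith
  · have := le_max_right (-llr μ ν x) 0
    have := le_abs_self (g x)
    linarith

theorem klDiv_eq_ofReal_integral_llr (hμν : μ ≪ ν) (h : Integrable (llr μ ν) μ) :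
    klDiv μ ν = ENNReal.ofReal (∫ x, llr μ ν x ∂μ) := by
  rw [klDiv_of_ac_of_integrable hμν h]
  simp

theorem klDiv_le_ofReal_integral (hμν : μ ≪ ν) {g : α → ℝ} (hg : Integrable g μ)
    (h : ∀ᵐ x ∂μ, llr μ ν x ≤ g x) : klDiv μ ν ≤ ENNReal.ofReal (∫ x, g x ∂μ) := by
  have hi := integrable_llr_of_ae_le hμν hg h
  rw [klDiv_eq_ofReal_integral_llr hμν hi]
  exact ENNReal.ofReal_le_ofReal (integral_mono_ae hi hg h)

theorem ofReal_integral_le_klDiv {g : α → ℝ} (hg : Integrable g μ)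
    (h : ∀ᵐ x ∂μ, g x ≤ llr μ ν x) : ENNReal.ofReal (∫ x, g x ∂μ) ≤ klDiv μ ν := by
  by_cases hi : μ ≪ ν ∧ Integrable (llr μ ν) μ
  · rw [klDiv_eq_ofReal_integral_llr hi.1 hi.2]
    exact ENNReal.ofReal_le_ofReal (integral_mono_ae hg hi.2 h)
  · have : klDiv μ ν = ∞ := by
      by_contra hne
      exact hi (klDiv_ne_top_iff.1 hne)
    simp [this]

end KullbackLeibler

/-! ### Additive noise channels with a noise density -/

section Channel

variable {p : ℕ}

/-- The density `y ↦ ∫ f(y - x) dμ(x)` of the output `X + N` when `X ∼ μ` and `N` has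
density `f`. -/
noncomputable def outputDensity (f : EuclideanSpace ℝ (Fin p) → ℝ)
    (μ : Measure (EuclideanSpace ℝ (Fin p))) (y : EuclideanSpace ℝ (Fin p)) : ℝ≥0∞ :=
  ∫⁻ x, ENNReal.ofReal (f (y - x)) ∂μ

variable {f : EuclideanSpace ℝ (Fin p) → ℝ} {μ : Measure (EuclideanSpace ℝ (Fin p))}

theorem measurable_outputDensity [SFinite μ] (hf : Measurable f) :
    Measurable (outputDensity f μ) := by
  unfold outputDensity
  exact Measurable.lintegral_prod_right'
    (f := fun z : EuclideanSpace ℝ (Fin p) × EuclideanSpace ℝ (Fin p) =>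
      ENNReal.ofReal (f (z.1 - z.2)))
    (by fun_prop)

theorem outputDensity_pos [IsProbabilityMeasure μ] (hf : Measurable f) (hpos : ∀ n, 0 < f n)
    (y : EuclideanSpace ℝ (Fin p)) : 0 < outputDensity f μ y := by
  unfold outputDensity
  rw [lintegral_pos_iff_support (by fun_prop)]
  have : (Function.support fun x => ENNReal.ofReal (f (y - x))) = Set.univ := by
    ext x
    simp [hpos]
  simp [this]

theorem outputDensity_le [IsProbabilityMeasure μ] {M : ℝ} (hM : ∀ n, f n ≤ M)
    (y : EuclideanSpace ℝ (Fin p)) : outputDensity f μ y ≤ ENNReal.ofReal M := by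
  unfold outputDensity
  calc _ ≤ ∫⁻ _, ENNReal.ofReal M ∂μ :=
        lintegral_mono fun x => ENNReal.ofReal_le_ofReal (hM _)
    _ = _ := by simp

theorem measurable_channel :
    Measurable fun z : EuclideanSpace ℝ (Fin p) × EuclideanSpace ℝ (Fin p) => (z.1, z.1 + z.2) := by
  fun_prop

/-- The joint law of input and output has density `f(y - x)` with respect to `μ ⊗ dy`. -/
theorem additiveChannelLaw_eq_withDensity [SFinite μ] (hf : Measurable f) :
    additiveChannelLaw (volume.withDensity fun n => ENNReal.ofReal (f n)) μ
      = (μ.prod volume).withDensity fun z => ENNReal.ofReal (f (z.2 - z.1)) := by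
  have hm : Measurable fun n => ENNReal.ofReal (f n) := by fun_prop
  have hm2 : Measurable fun z : EuclideanSpace ℝ (Fin p) × EuclideanSpace ℝ (Fin p) =>
    ENNReal.ofReal (f (z.2 - z.1)) := by fun_prop
  refine Measure.ext_of_lintegral _ fun h hh => ?_
  rw [additiveChannelLaw, lintegral_map hh measurable_channel, prod_withDensity_right hm,
    lintegral_withDensity_eq_lintegral_mul _ (by fun_prop) (by fun_prop),
    lintegral_withDensity_eq_lintegral_mul _ hm2 hh,
    lintegral_prod _ (by fun_prop), lintegral_prod _ (by fun_prop)]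
  refine lintegral_congr fun x => ?_
  rw [← lintegral_sub_right_eq_self _ x]
  simp

theorem isProbabilityMeasure_additiveChannelLaw {ν : Measure (EuclideanSpace ℝ (Fin p))}
    [IsProbabilityMeasure μ] [IsProbabilityMeasure ν] :
    IsProbabilityMeasure (additiveChannelLaw ν μ) :=
  Measure.isProbabilityMeasure_map measurable_channel.aemeasurable

theorem fst_additiveChannelLaw {ν : Measure (EuclideanSpace ℝ (Fin p))}
    [IsProbabilityMeasure μ] [IsProbabilityMeasure ν] :
    (additiveChannelLaw ν μ).fst = μ := by
  rw [additiveChannelLaw, Measure.fst, Measure.map_map measurable_fst measurable_channel]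
  change ((μ.prod ν).map Prod.fst) = μ
  simp

theorem snd_additiveChannelLaw [SFinite μ] (hf : Measurable f) :
    (additiveChannelLaw (volume.withDensity fun n => ENNReal.ofReal (f n)) μ).snd
      = volume.withDensity (outputDensity f μ) := by
  have hm2 : Measurable fun z : EuclideanSpace ℝ (Fin p) × EuclideanSpace ℝ (Fin p) =>
    ENNReal.ofReal (f (z.2 - z.1)) := by fun_prop
  refine Measure.ext_of_lintegral _ fun h hh => ?_
  rw [additiveChannelLaw_eq_withDensity hf, Measure.snd, lintegral_map hh measurable_snd,
    lintegral_withDensity_eq_lintegral_mul _ hm2 (by fun_prop),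
    lintegral_withDensity_eq_lintegral_mul _ (measurable_outputDensity hf) hh,
    lintegral_prod_symm _ (by fun_prop)]
  refine lintegral_congr fun y => ?_
  simp only [Pi.mul_apply, outputDensity]
  rw [lintegral_mul_const _ (by fun_prop)]

/-- The joint law has density `f(y - x) / f_Y(y)` with respect to the product of its marginals. -/
theorem additiveChannelLaw_eq_withDensity_prod [IsProbabilityMeasure μ] (hf : Measurable f)
    (hpos : ∀ n, 0 < f n) {M : ℝ} (hM : ∀ n, f n ≤ M) :
    additiveChannelLaw (volume.withDensity fun n => ENNReal.ofReal (f n)) μ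
      = (μ.prod (volume.withDensity (outputDensity f μ))).withDensity fun z =>
          ENNReal.ofReal (f (z.2 - z.1)) / outputDensity f μ z.2 := by
  have hm := measurable_outputDensity (μ := μ) hf
  rw [additiveChannelLaw_eq_withDensity hf, prod_withDensity_right hm,
    ← withDensity_mul _ (by fun_prop) (by fun_prop)]
  congr 1
  ext z
  simp only [Pi.mul_apply]
  rw [ENNReal.mul_div_cancel (outputDensity_pos hf hpos _).ne'
    ((outputDensity_le hM _).trans_lt ENNReal.ofReal_lt_top).ne]

variable [IsProbabilityMeasure (volume.withDensity fun n => ENNReal.ofReal (f n))]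

theorem isProbabilityMeasure_withDensity_outputDensity [IsProbabilityMeasure μ]
    (hf : Measurable f) : IsProbabilityMeasure (volume.withDensity (outputDensity f μ)) := by
  have := isProbabilityMeasure_additiveChannelLaw
    (ν := volume.withDensity fun n => ENNReal.ofReal (f n)) (μ := μ)
  rw [← snd_additiveChannelLaw hf]
  infer_instance

/-- Absolute continuity and the log-likelihood ratio of the joint law relative to the product of
its marginals. -/
theorem llr_additiveChannelLaw [IsProbabilityMeasure μ] (hf : Measurable f)
    (hpos : ∀ n, 0 < f n) {M : ℝ} (hM : ∀ n, f n ≤ M) :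
    additiveChannelLaw (volume.withDensity fun n => ENNReal.ofReal (f n)) μ
        ≪ μ.prod (volume.withDensity (outputDensity f μ)) ∧
    ∀ᵐ z ∂(additiveChannelLaw (volume.withDensity fun n => ENNReal.ofReal (f n)) μ),
      llr (additiveChannelLaw (volume.withDensity fun n => ENNReal.ofReal (f n)) μ)
        (μ.prod (volume.withDensity (outputDensity f μ))) z
      = Real.log (f (z.2 - z.1)) - Real.log (outputDensity f μ z.2).toReal := by
  have hm := measurable_outputDensity (μ := μ) hf
  have hP := isProbabilityMeasure_withDensity_outputDensity (μ := μ) hf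
  have key := additiveChannelLaw_eq_withDensity_prod (μ := μ) hf hpos hM
  have hac : additiveChannelLaw (volume.withDensity fun n => ENNReal.ofReal (f n)) μ
      ≪ μ.prod (volume.withDensity (outputDensity f μ)) := by
    rw [key]
    exact withDensity_absolutelyContinuous _ _
  refine ⟨hac, hac.ae_le ?_⟩
  have := Measure.rnDeriv_withDensity (μ.prod (volume.withDensity (outputDensity f μ)))
    (f := fun z => ENNReal.ofReal (f (z.2 - z.1)) / outputDensity f μ z.2) (by fun_prop)
  rw [← key] at this
  filter_upwards [this] with z hz
  have h1 := outputDensity_pos (μ := μ) hf hpos z.2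
  have h2 := ((outputDensity_le (μ := μ) hM z.2).trans_lt ENNReal.ofReal_lt_top).ne
  rw [llr, hz, ENNReal.toReal_div, ENNReal.toReal_ofReal (hpos _).le,
    Real.log_div (hpos _).ne' (ENNReal.toReal_pos h1.ne' h2).ne']

theorem mutualInfo_additiveChannelLaw [IsProbabilityMeasure μ] (hf : Measurable f) :
    mutualInfo (additiveChannelLaw (volume.withDensity fun n => ENNReal.ofReal (f n)) μ)
      = InformationTheory.klDiv
          (additiveChannelLaw (volume.withDensity fun n => ENNReal.ofReal (f n)) μ)
          (μ.prod (volume.withDensity (outputDensity f μ))) := by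
  rw [mutualInfo, snd_additiveChannelLaw hf, fst_additiveChannelLaw]

end Channel

/-! ### Gaussian integrals -/

theorem integrable_exp_neg_mul_norm_sq {p : ℕ} {b : ℝ} (hb : 0 < b) :
    Integrable fun v : EuclideanSpace ℝ (Fin p) => Real.exp (-b * ‖v‖ ^ 2) := by
  refine Integrable.of_integral_ne_zero ?_
  rw [GaussianFourier.integral_rexp_neg_mul_sq_norm hb]
  positivity

theorem lintegral_exp_neg_mul_norm_sq {p : ℕ} {b : ℝ} (hb : 0 < b) :
    ∫⁻ v : EuclideanSpace ℝ (Fin p), ENNReal.ofReal (Real.exp (-b * ‖v‖ ^ 2))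
      = ENNReal.ofReal ((Real.pi / b) ^ ((p : ℝ) / 2)) := by
  rw [← ofReal_integral_eq_lintegral_ofReal (integrable_exp_neg_mul_norm_sq hb)
    (ae_of_all _ fun _ => (Real.exp_pos _).le), GaussianFourier.integral_rexp_neg_mul_sq_norm hb]
  simp

/-! ### Capacity bounds for a bounded noise density with finite second moment -/

section Capacity

variable {p : ℕ} {f : EuclideanSpace ℝ (Fin p) → ℝ} {μ ν : Measure (EuclideanSpace ℝ (Fin p))}

/-- A function of the channel input, integrated against the joint law. -/
theorem integrable_and_integral_fst [IsProbabilityMeasure μ] [IsProbabilityMeasure ν]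
    {g : EuclideanSpace ℝ (Fin p) → ℝ} (hg : Integrable g μ) :
    Integrable (fun z => g z.1) (additiveChannelLaw ν μ) ∧
      ∫ z, g z.1 ∂additiveChannelLaw ν μ = ∫ x, g x ∂μ := by
  have h : (additiveChannelLaw ν μ).map Prod.fst = μ := fst_additiveChannelLaw
  have hg' : Integrable g ((additiveChannelLaw ν μ).map Prod.fst) := by rwa [h]
  refine ⟨hg'.comp_measurable measurable_fst, ?_⟩
  rw [← integral_map measurable_fst.aemeasurable hg'.aestronglyMeasurable, h]

/-- A function of the noise `y - x`, integrated against the joint law. -/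
theorem integrable_and_integral_sub [IsProbabilityMeasure μ] [IsProbabilityMeasure ν]
    {g : EuclideanSpace ℝ (Fin p) → ℝ} (hg : Integrable g ν) :
    Integrable (fun z => g (z.2 - z.1)) (additiveChannelLaw ν μ) ∧
      ∫ z, g (z.2 - z.1) ∂additiveChannelLaw ν μ = ∫ x, g x ∂ν := by
  have hm : Measurable fun z : EuclideanSpace ℝ (Fin p) × EuclideanSpace ℝ (Fin p) =>
    z.2 - z.1 := by fun_prop
  have h : (additiveChannelLaw ν μ).map (fun z => z.2 - z.1) = ν := by
    rw [additiveChannelLaw, Measure.map_map hm measurable_channel]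
    have : (fun z : EuclideanSpace ℝ (Fin p) × EuclideanSpace ℝ (Fin p) => z.2 - z.1) ∘
        (fun z => (z.1, z.1 + z.2)) = Prod.snd := by
      ext1 z
      simp
    rw [this]
    change (μ.prod ν).snd = ν
    simp
  have hg' : Integrable g ((additiveChannelLaw ν μ).map fun z => z.2 - z.1) := by rwa [h]
  refine ⟨hg'.comp_measurable hm, ?_⟩
  rw [← integral_map hm.aemeasurable hg'.aestronglyMeasurable, h]

variable [IsProbabilityMeasure (volume.withDensity fun n => ENNReal.ofReal (f n))]

/-- For a probability density `q`, the ratio `q / f_Y` has mean `1` under the joint law. -/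
theorem integrable_and_integral_div_outputDensity [IsProbabilityMeasure μ] (hf : Measurable f)
    (hpos : ∀ n, 0 < f n) {M : ℝ} (hM : ∀ n, f n ≤ M) {q : EuclideanSpace ℝ (Fin p) → ℝ}
    (hq : Measurable q) (hq0 : ∀ y, 0 ≤ q y) (hq1 : ∫⁻ y, ENNReal.ofReal (q y) = 1) :
    Integrable (fun z => q z.2 / (outputDensity f μ z.2).toReal)
      (additiveChannelLaw (volume.withDensity fun n => ENNReal.ofReal (f n)) μ) ∧
    ∫ z, q z.2 / (outputDensity f μ z.2).toReal
      ∂additiveChannelLaw (volume.withDensity fun n => ENNReal.ofReal (f n)) μ = 1 := by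
  have hm := measurable_outputDensity (μ := μ) hf
  have hP := isProbabilityMeasure_additiveChannelLaw
    (ν := volume.withDensity fun n => ENNReal.ofReal (f n)) (μ := μ)
  have hr0 : ∀ z : EuclideanSpace ℝ (Fin p) × EuclideanSpace ℝ (Fin p),
      0 ≤ q z.2 / (outputDensity f μ z.2).toReal := fun z => div_nonneg (hq0 _) (by positivity)
  have hrm : Measurable fun y => q y / (outputDensity f μ y).toReal := by fun_prop
  have hrm2 : AEStronglyMeasurable
      (fun z : EuclideanSpace ℝ (Fin p) × EuclideanSpace ℝ (Fin p) =>
        q z.2 / (outputDensity f μ z.2).toReal)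
      (additiveChannelLaw (volume.withDensity fun n => ENNReal.ofReal (f n)) μ) :=
    (hrm.comp measurable_snd).aestronglyMeasurable
  have key : ∫⁻ z, ENNReal.ofReal (q z.2 / (outputDensity f μ z.2).toReal)
      ∂additiveChannelLaw (volume.withDensity fun n => ENNReal.ofReal (f n)) μ = 1 := by
    rw [← lintegral_map (f := fun y => ENNReal.ofReal (q y / (outputDensity f μ y).toReal))
      (by fun_prop) measurable_snd]
    change ∫⁻ y, _ ∂(Measure.snd _) = 1
    rw [snd_additiveChannelLaw hf, lintegral_withDensity_eq_lintegral_mul _ hm (by fun_prop), ← hq1]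
    refine lintegral_congr fun y => ?_
    have h1 := outputDensity_pos (μ := μ) hf hpos y
    have h2 := ((outputDensity_le (μ := μ) hM y).trans_lt ENNReal.ofReal_lt_top).ne
    have h3 := ENNReal.toReal_pos h1.ne' h2
    simp only [Pi.mul_apply]
    rw [ENNReal.ofReal_div_of_pos h3, ENNReal.ofReal_toReal h2, ENNReal.mul_div_cancel h1.ne' h2]
  refine ⟨⟨hrm2, ?_⟩, ?_⟩
  · rw [hasFiniteIntegral_iff_ofReal (ae_of_all _ hr0), key]
    exact ENNReal.one_lt_top
  · rw [integral_eq_lintegral_of_nonneg_ae (ae_of_all _ hr0) hrm2, key]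
    simp

/-- The mutual information is at most `log M` plus the cross entropy of the output relative to
any probability density `q` whose negative logarithm is at most `c + b ‖y‖²`; here
`‖y‖² ≤ 2 ‖x‖² + 2 ‖y - x‖²` separates the input from the noise. -/
theorem mutualInfo_le [IsProbabilityMeasure μ] (hf : Measurable f)
    (hpos : ∀ n, 0 < f n) {M : ℝ} (hM : ∀ n, f n ≤ M)
    (hint : Integrable (fun n => ‖n‖ ^ 2) (volume.withDensity fun n => ENNReal.ofReal (f n)))
    (hμ : Integrable (fun n => ‖n‖ ^ 2) μ) {q : EuclideanSpace ℝ (Fin p) → ℝ}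
    (hq : Measurable q) (hq0 : ∀ y, 0 < q y) (hq1 : ∫⁻ y, ENNReal.ofReal (q y) = 1)
    {b c : ℝ} (hb : 0 ≤ b) (hqb : ∀ y, -Real.log (q y) ≤ c + b * ‖y‖ ^ 2) :
    mutualInfo (additiveChannelLaw (volume.withDensity fun n => ENNReal.ofReal (f n)) μ)
      ≤ ENNReal.ofReal (Real.log M + c + 2 * b * ∫ x, ‖x‖ ^ 2 ∂μ
        + 2 * b * ∫ n, ‖n‖ ^ 2 ∂(volume.withDensity fun n => ENNReal.ofReal (f n))) := by
  have hP := isProbabilityMeasure_additiveChannelLaw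
    (ν := volume.withDensity fun n => ENNReal.ofReal (f n)) (μ := μ)
  have hY := isProbabilityMeasure_withDensity_outputDensity (μ := μ) hf
  rw [mutualInfo_additiveChannelLaw hf]
  obtain ⟨hac, hllr⟩ := llr_additiveChannelLaw (μ := μ) hf hpos hM
  obtain ⟨i1, e1⟩ := integrable_and_integral_fst
    (ν := volume.withDensity fun n => ENNReal.ofReal (f n)) hμ
  obtain ⟨i2, e2⟩ := integrable_and_integral_sub (μ := μ) hint
  obtain ⟨i3, e3⟩ := integrable_and_integral_div_outputDensity (μ := μ) hf hpos hM hq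
    (fun y => (hq0 y).le) hq1
  have ic := integrable_const (μ := additiveChannelLaw
    (volume.withDensity fun n => ENNReal.ofReal (f n)) μ) (Real.log M + c - 1)
  have j1 := i1.const_mul (2 * b)
  have j2 := i2.const_mul (2 * b)
  refine (klDiv_le_ofReal_integral hac (((ic.add j1).add j2).add i3) ?_).trans_eq ?_
  · filter_upwards [hllr] with z hz
    rw [hz]
    have h1 := outputDensity_pos (μ := μ) hf hpos z.2
    have h2 := ((outputDensity_le (μ := μ) hM z.2).trans_lt ENNReal.ofReal_lt_top).ne
    have h3 := ENNReal.toReal_pos h1.ne' h2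
    -- `log t ≤ t - 1` at `t = q / f_Y` bounds `-log f_Y` by an integrable function.
    have h4 := Real.log_le_sub_one_of_pos (div_pos (hq0 z.2) h3)
    rw [Real.log_div (hq0 _).ne' h3.ne'] at h4
    have h5 : Real.log (f (z.2 - z.1)) ≤ Real.log M := Real.log_le_log (hpos _) (hM _)
    have h6 := hqb z.2
    have h7 : ‖z.2‖ ^ 2 ≤ 2 * ‖z.1‖ ^ 2 + 2 * ‖z.2 - z.1‖ ^ 2 := by
      have h8 : ‖z.2‖ ≤ ‖z.1‖ + ‖z.2 - z.1‖ := by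
        simpa using norm_add_le z.1 (z.2 - z.1)
      have h9 := norm_nonneg z.2
      nlinarith [sq_nonneg (‖z.1‖ - ‖z.2 - z.1‖)]
    have h8 := mul_le_mul_of_nonneg_left h7 hb
    simp only [Pi.add_apply]
    linarith
  · rw [integral_add' ((ic.add j1).add j2) i3, integral_add' (ic.add j1) j2, integral_add' ic j1,
      integral_const_mul, integral_const_mul, e1, e2, e3]
    simp only [integral_const, probReal_univ, one_smul]
    congr 1
    ring

/-- The upper bound on the capacity: the comparison density `q` is the centred Gaussian with
density proportional to `exp (-‖y‖² / P)`. -/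
theorem channelCapacity_le (hf : Measurable f)
    (hpos : ∀ n, 0 < f n) {M : ℝ} (hM : ∀ n, f n ≤ M)
    (hint : Integrable (fun n => ‖n‖ ^ 2) (volume.withDensity fun n => ENNReal.ofReal (f n)))
    {P : ℝ} (hP : 1 ≤ P) :
    channelCapacity (volume.withDensity fun n => ENNReal.ofReal (f n)) P
      ≤ ENNReal.ofReal ((p : ℝ) / 2 * Real.log P + (Real.log M + (p : ℝ) / 2 * Real.log Real.pi
        + 2 + 2 * ∫ n, ‖n‖ ^ 2 ∂(volume.withDensity fun n => ENNReal.ofReal (f n)))) := by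
  have hP0 : 0 < P := by linarith
  refine iSup₂_le fun μ hμ => ?_
  obtain ⟨hμ1, hμ2⟩ := hμ
  have hsq : ∀ x : EuclideanSpace ℝ (Fin p), ‖x‖ₑ ^ 2 = ENNReal.ofReal (‖x‖ ^ 2) := fun x => by
    rw [← ofReal_norm, ENNReal.ofReal_pow (norm_nonneg _)]
  simp only [hsq] at hμ2
  have hm : AEStronglyMeasurable (fun x : EuclideanSpace ℝ (Fin p) => ‖x‖ ^ 2) μ := by fun_prop
  have h0 : ∀ᵐ x ∂μ, 0 ≤ ‖x‖ ^ 2 := ae_of_all _ fun x => by positivity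
  have hμi : Integrable (fun x => ‖x‖ ^ 2) μ := by
    refine ⟨hm, ?_⟩
    rw [hasFiniteIntegral_iff_ofReal h0]
    exact hμ2.trans_lt ENNReal.ofReal_lt_top
  have hμP : ∫ x, ‖x‖ ^ 2 ∂μ ≤ P := by
    rw [integral_eq_lintegral_of_nonneg_ae h0 hm]
    exact ENNReal.toReal_le_of_le_ofReal hP0.le hμ2
  set Z : ℝ := (Real.pi / P⁻¹) ^ ((p : ℝ) / 2) with hZ
  have hZ0 : 0 < Z := by positivity
  have hlogZ : Real.log Z = (p : ℝ) / 2 * Real.log Real.pi + (p : ℝ) / 2 * Real.log P := by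
    rw [hZ, Real.log_rpow (by positivity), div_inv_eq_mul,
      Real.log_mul Real.pi_pos.ne' hP0.ne']
    ring
  refine (mutualInfo_le hf hpos hM hint hμi (q := fun y => Real.exp (-P⁻¹ * ‖y‖ ^ 2) / Z)
    (b := P⁻¹) (c := Real.log Z) (by fun_prop) (fun y => by positivity) ?_ (by positivity)
    fun y => ?_).trans ?_
  · simp only [ENNReal.ofReal_div_of_pos hZ0]
    simp only [div_eq_mul_inv]
    rw [lintegral_mul_const _ (by fun_prop), lintegral_exp_neg_mul_norm_sq (by positivity), ← hZ]
    exact ENNReal.mul_inv_cancel (by simpa using hZ0) ENNReal.ofReal_ne_top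
  · rw [Real.log_div (Real.exp_ne_zero _) hZ0.ne', Real.log_exp]
    linarith
  · refine ENNReal.ofReal_le_ofReal ?_
    have hS : 0 ≤ ∫ n, ‖n‖ ^ 2 ∂(volume.withDensity fun n => ENNReal.ofReal (f n)) :=
      integral_nonneg fun n => by positivity
    have h1 : P⁻¹ * ∫ x, ‖x‖ ^ 2 ∂μ ≤ 1 := by
      rw [inv_mul_le_one₀ hP0]
      exact hμP
    have h2 : P⁻¹ * ∫ n, ‖n‖ ^ 2 ∂(volume.withDensity fun n => ENNReal.ofReal (f n))
        ≤ 1 * ∫ n, ‖n‖ ^ 2 ∂(volume.withDensity fun n => ENNReal.ofReal (f n)) := by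
      gcongr
      exact inv_le_one_of_one_le₀ hP
    rw [hlogZ]
    linarith

/-- The uniform distribution on a set `s` of finite positive volume has density `1 / vol s`, so the
output density is bounded by that number. -/
theorem outputDensity_cond_le (s : Set (EuclideanSpace ℝ (Fin p)))
    (y : EuclideanSpace ℝ (Fin p)) :
    outputDensity f (ProbabilityTheory.cond volume s) y ≤ (volume s)⁻¹ := by
  have h1 : ∫⁻ n, ENNReal.ofReal (f n) = 1 := by
    have := measure_univ (μ := volume.withDensity fun n => ENNReal.ofReal (f n))
    rwa [withDensity_apply _ MeasurableSet.univ, Measure.restrict_univ] at this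
  rw [outputDensity, ProbabilityTheory.cond, lintegral_smul_measure, smul_eq_mul]
  calc _ ≤ (volume s)⁻¹ * ∫⁻ x, ENNReal.ofReal (f (y - x)) := by
        gcongr
        exact Measure.restrict_le_self
    _ = (volume s)⁻¹ := by
        rw [lintegral_sub_left_eq_self (fun n => ENNReal.ofReal (f n)), h1, mul_one]

/-- The lower bound on the capacity: the input is uniform on the ball of radius `√P`. -/
theorem le_channelCapacity (hf : Measurable f)
    (hpos : ∀ n, 0 < f n) {M : ℝ} (hM : ∀ n, f n ≤ M)
    (hint : Integrable (fun n => ‖n‖ ^ 2) (volume.withDensity fun n => ENNReal.ofReal (f n)))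
    {a b : ℝ} (hab : ∀ n, a - b * ‖n‖ ^ 2 ≤ Real.log (f n)) {P : ℝ} (hP : 0 < P) :
    ENNReal.ofReal ((p : ℝ) / 2 * Real.log P +
        (Real.log (volume (Metric.ball (0 : EuclideanSpace ℝ (Fin p)) 1)).toReal + a
        - b * ∫ n, ‖n‖ ^ 2 ∂(volume.withDensity fun n => ENNReal.ofReal (f n))))
      ≤ channelCapacity (volume.withDensity fun n => ENNReal.ofReal (f n)) P := by
  set s := Metric.ball (0 : EuclideanSpace ℝ (Fin p)) (√P) with hs
  have hsP : 0 < √P := Real.sqrt_pos.2 hP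
  have hs0 : volume s ≠ 0 := (Metric.measure_ball_pos volume _ hsP).ne'
  have hst : volume s ≠ ∞ := measure_ball_lt_top.ne
  have hμ := ProbabilityTheory.cond_isProbabilityMeasure_of_finite hs0 hst
  set μ := ProbabilityTheory.cond volume s with hμdef
  have hv0 : 0 < (volume (Metric.ball (0 : EuclideanSpace ℝ (Fin p)) 1)).toReal :=
    ENNReal.toReal_pos (Metric.measure_ball_pos volume _ one_pos).ne' measure_ball_lt_top.ne
  have hlogs : Real.log (volume s).toReal = (p : ℝ) / 2 * Real.log P +
      Real.log (volume (Metric.ball (0 : EuclideanSpace ℝ (Fin p)) 1)).toReal := by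
    rw [hs, Measure.addHaar_ball_of_pos _ _ hsP, ENNReal.toReal_mul,
      ENNReal.toReal_ofReal (by positivity), Real.log_mul (by positivity) hv0.ne', Real.log_pow,
      Real.log_sqrt hP.le, finrank_euclideanSpace_fin]
    ring
  have hmem : ∫⁻ x, ‖x‖ₑ ^ 2 ∂μ ≤ ENNReal.ofReal P := by
    calc ∫⁻ x, ‖x‖ₑ ^ 2 ∂μ ≤ ∫⁻ _, ENNReal.ofReal P ∂μ := by
          refine lintegral_mono_ae ?_
          filter_upwards [ProbabilityTheory.ae_cond_mem (μ := volume) measurableSet_ball] with x hx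
          rw [← ofReal_norm, ← ENNReal.ofReal_pow (norm_nonneg _)]
          refine ENNReal.ofReal_le_ofReal ?_
          have h1 : ‖x‖ < √P := mem_ball_zero_iff.1 hx
          calc ‖x‖ ^ 2 ≤ √P ^ 2 := by gcongr
            _ = P := Real.sq_sqrt hP.le
      _ = ENNReal.ofReal P := by simp
  refine le_trans ?_ (le_iSup₂ (α := ℝ≥0∞) μ ⟨hμ, hmem⟩)
  have hPr := isProbabilityMeasure_additiveChannelLaw
    (ν := volume.withDensity fun n => ENNReal.ofReal (f n)) (μ := μ)
  have hY := isProbabilityMeasure_withDensity_outputDensity (μ := μ) hf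
  rw [mutualInfo_additiveChannelLaw hf]
  obtain ⟨-, hllr⟩ := llr_additiveChannelLaw (μ := μ) hf hpos hM
  obtain ⟨i2, e2⟩ := integrable_and_integral_sub (μ := μ) hint
  have ic := integrable_const (μ := additiveChannelLaw
    (volume.withDensity fun n => ENNReal.ofReal (f n)) μ) (Real.log (volume s).toReal + a)
  have j2 := i2.const_mul b
  refine le_trans (le_of_eq ?_) (ofReal_integral_le_klDiv (ic.sub j2) ?_)
  · rw [integral_sub' ic j2, integral_const_mul, e2]
    simp only [integral_const, probReal_univ, one_smul]
    rw [hlogs]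
    congr 1
    ring
  · filter_upwards [hllr] with z hz
    rw [hz]
    have h1 := outputDensity_pos (μ := μ) hf hpos z.2
    have h2 := ((outputDensity_le (μ := μ) hM z.2).trans_lt ENNReal.ofReal_lt_top).ne
    have h3 := ENNReal.toReal_pos h1.ne' h2
    have h4 : (outputDensity f μ z.2).toReal ≤ (volume s).toReal⁻¹ := by
      rw [← ENNReal.toReal_inv]
      exact ENNReal.toReal_mono (ENNReal.inv_ne_top.2 hs0) (outputDensity_cond_le s z.2)
    have h5 := Real.log_le_log h3 h4
    rw [Real.log_inv] at h5
    have h6 := hab (z.2 - z.1)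
    simp only [Pi.sub_apply]
    linarith

end Capacity

/-! ### The modified Bessel function -/

theorem Real.cosh_eq_one_add_two_mul_sinh_half_sq (t : ℝ) :
    Real.cosh t = 1 + 2 * Real.sinh (t / 2) ^ 2 := by
  have := Real.cosh_two_mul (t / 2)
  rw [Real.cosh_sq', mul_div_cancel₀ _ (two_ne_zero' ℝ)] at this
  linarith

theorem Real.one_add_sq_div_two_le_cosh (t : ℝ) : 1 + t ^ 2 / 2 ≤ Real.cosh t := by
  have h2 : |t / 2| ≤ |Real.sinh (t / 2)| := by
    rw [Real.abs_sinh]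
    exact Real.self_le_sinh_iff.2 (abs_nonneg _)
  have h3 := sq_le_sq.2 h2
  rw [Real.cosh_eq_one_add_two_mul_sinh_half_sq]
  linarith

theorem integrable_exp_neg_mul_cosh_sub {z : ℝ} (hz : 0 < z) (ν : ℝ) :
    Integrable fun t : ℝ => Real.exp (-z * Real.cosh t - ν * t) := by
  refine Integrable.mono' ((integrable_exp_neg_mul_sq (b := z / 4) (by positivity)).const_mul
    (Real.exp (ν ^ 2 / z))) (by fun_prop) (ae_of_all _ fun t => ?_)
  rw [Real.norm_of_nonneg (Real.exp_pos _).le, ← Real.exp_add]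
  refine Real.exp_le_exp.2 ?_
  have h1 := mul_le_mul_of_nonneg_left (Real.one_add_sq_div_two_le_cosh t) hz.le
  have h2 : ν ^ 2 / z + z / 4 * t ^ 2 + ν * t = (ν + z / 2 * t) ^ 2 / z := by
    field_simp
    ring
  have h3 : 0 ≤ (ν + z / 2 * t) ^ 2 / z := by positivity
  nlinarith

/-- The integral representation of `K_ν` over the whole line. -/
theorem integral_exp_neg_mul_cosh_sub {z : ℝ} (hz : 0 < z) (ν : ℝ) :
    ∫ t : ℝ, Real.exp (-z * Real.cosh t - ν * t) = 2 * besselK ν z := by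
  have hi := integrable_exp_neg_mul_cosh_sub hz ν
  have hneg := integral_comp_neg_Ioi (0 : ℝ) fun t => Real.exp (-z * Real.cosh t - ν * t)
  rw [neg_zero] at hneg
  rw [← intervalIntegral.integral_Iic_add_Ioi (b := (0 : ℝ)) hi.integrableOn hi.integrableOn,
    ← hneg, ← integral_add hi.comp_neg.integrableOn hi.integrableOn, besselK, ← integral_const_mul]
  refine integral_congr_ae (ae_of_all _ fun t => ?_)
  simp only [Real.cosh_neg, Real.cosh_eq (ν * t), sub_eq_add_neg, Real.exp_add]
  ring_nf

/-- The order `1/2` is elementary: substitute `s = sinh (t / 2)` in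
`∫ exp (-z (1 + 2 sinh² (t / 2))) cosh (t / 2) dt`. For `z ≤ 0` the integral diverges and both
sides are `0` by convention. -/
theorem besselK_one_half (z : ℝ) :
    besselK (1 / 2) z = √(Real.pi / (2 * z)) * Real.exp (-z) := by
  have hder : ∀ t ∈ Set.Ioi (0 : ℝ), HasDerivWithinAt (fun t => Real.sinh (t / 2))
      (Real.cosh (t / 2) * (1 / 2)) (Set.Ioi 0) t := fun t _ =>
    (((hasDerivAt_id t).div_const 2).sinh).hasDerivWithinAt
  have hinj : Set.InjOn (fun t : ℝ => Real.sinh (t / 2)) (Set.Ioi 0) := fun a _ b _ h => by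
    have := Real.sinh_injective h
    linarith
  have himg : (fun t : ℝ => Real.sinh (t / 2)) '' Set.Ioi 0 = Set.Ioi 0 := by
    ext s
    constructor
    · rintro ⟨t, ht, rfl⟩
      exact Real.sinh_pos_iff.2 (half_pos ht)
    · intro hs
      refine ⟨2 * Real.arsinh s, ?_, ?_⟩
      · have := Real.arsinh_pos_iff.2 hs
        simpa using this
      · simp [Real.sinh_arsinh]
  have h := integral_image_eq_integral_abs_deriv_smul measurableSet_Ioi hder hinj
    fun s => Real.exp (-(2 * z) * s ^ 2)
  rw [himg, integral_gaussian_Ioi] at h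
  have h2 : besselK (1 / 2) z = 2 * Real.exp (-z) * (√(Real.pi / (2 * z)) / 2) := by
    rw [h, besselK, ← integral_const_mul]
    refine integral_congr_ae (ae_of_all _ fun t => ?_)
    have he : Real.exp (-z * Real.cosh t)
        = Real.exp (-z) * Real.exp (-(2 * z) * Real.sinh (t / 2) ^ 2) := by
      rw [← Real.exp_add, Real.cosh_eq_one_add_two_mul_sinh_half_sq]
      ring_nf
    simp only [smul_eq_mul]
    rw [he, abs_of_pos (by positivity), one_div_mul_eq_div]
    ring
  rw [h2]
  ring

/-! ### The noise density as a mixture of Gaussian densities -/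

/-- The weight `exp (-(u / 2) (e^τ + s e^{-τ}) - ν τ)`. For `s = ‖n‖² + λ²` it is, as a function
of `n`, a multiple of a centred Gaussian density of variance `e^τ / u`. -/
noncomputable def mixtureWeight (ν u s τ : ℝ) : ℝ :=
  Real.exp (-(u / 2) * (Real.exp τ + s * Real.exp (-τ)) - ν * τ)

theorem mixtureWeight_pos (ν u s τ : ℝ) : 0 < mixtureWeight ν u s τ := Real.exp_pos _

/-- Shifting `τ` by `log r` turns the weight into the integrand of `K_ν(u r)`. -/
theorem mixtureWeight_add_log (ν u : ℝ) {r : ℝ} (hr : 0 < r) (t : ℝ) :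
    mixtureWeight ν u (r ^ 2) (t + Real.log r)
      = Real.exp (-(u * r) * Real.cosh t - ν * t) * r ^ (-ν) := by
  rw [mixtureWeight, Real.rpow_def_of_pos hr, ← Real.exp_add, neg_add, Real.exp_add, Real.exp_add,
    Real.exp_neg (Real.log r), Real.exp_log hr, Real.cosh_eq]
  congr 1
  field_simp
  ring

theorem integrable_mixtureWeight (ν : ℝ) {u r : ℝ} (hu : 0 < u) (hr : 0 < r) :
    Integrable (mixtureWeight ν u (r ^ 2)) := by
  have h : Integrable fun t => mixtureWeight ν u (r ^ 2) (t + Real.log r) := by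
    simp only [mixtureWeight_add_log ν u hr]
    exact (integrable_exp_neg_mul_cosh_sub (mul_pos hu hr) ν).mul_const _
  simpa using h.comp_add_right (-Real.log r)

theorem integral_mixtureWeight (ν : ℝ) {u r : ℝ} (hu : 0 < u) (hr : 0 < r) :
    ∫ τ, mixtureWeight ν u (r ^ 2) τ = 2 * besselK ν (u * r) * r ^ (-ν) := by
  rw [← integral_add_right_eq_self _ (Real.log r)]
  simp only [mixtureWeight_add_log ν u hr]
  rw [integral_mul_const, integral_exp_neg_mul_cosh_sub (mul_pos hu hr)]

theorem mixtureWeight_add (ν u s τ x : ℝ) :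
    mixtureWeight ν u (x + s) τ
      = mixtureWeight ν u s τ * Real.exp (-(u / 2 * Real.exp (-τ)) * x) := by
  rw [mixtureWeight, mixtureWeight, ← Real.exp_add]
  ring_nf

@[fun_prop]
theorem continuous_mixtureWeight {X : Type*} [TopologicalSpace X] (ν u : ℝ) {s τ : X → ℝ}
    (hs : Continuous s) (hτ : Continuous τ) : Continuous fun x => mixtureWeight ν u (s x) (τ x) := by
  unfold mixtureWeight
  fun_prop

/-- Integrating out the Gaussian factor lowers the order of the weight by `p / 2`. -/
theorem lintegral_mixtureWeight_mul_exp {p : ℕ} (ν u s τ : ℝ) {b : ℝ} (hb : 0 < b) :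
    ∫⁻ n : EuclideanSpace ℝ (Fin p),
        ENNReal.ofReal (mixtureWeight ν u s τ * Real.exp (-(b * Real.exp (-τ)) * ‖n‖ ^ 2))
      = ENNReal.ofReal ((Real.pi / b) ^ ((p : ℝ) / 2) * mixtureWeight (ν - p / 2) u s τ) := by
  simp only [ENNReal.ofReal_mul (mixtureWeight_pos ν u s τ).le]
  rw [lintegral_const_mul _ (by fun_prop), lintegral_exp_neg_mul_norm_sq (by positivity),
    ← ENNReal.ofReal_mul (mixtureWeight_pos ν u s τ).le]
  congr 1
  have h1 : Real.pi / (b * Real.exp (-τ)) = Real.pi / b * Real.exp τ := by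
    rw [Real.exp_neg]
    field_simp
  rw [h1, Real.mul_rpow (by positivity) (by positivity), ← Real.exp_mul]
  unfold mixtureWeight
  rw [mul_left_comm, ← Real.exp_add]
  ring_nf

/-- The constant in front of the Gaussian mixture. -/
noncomputable def mixtureConst (ν lam u : ℝ) : ℝ :=
  lam / ((2 : ℝ) ^ (ν - 1) * Real.pi ^ ν) * u ^ ν * Real.exp (lam * u) / 2

theorem mixtureConst_pos (ν : ℝ) {lam u : ℝ} (hlam : 0 < lam) (hu : 0 < u) :
    0 < mixtureConst ν lam u := by
  unfold mixtureConst
  positivity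

theorem hyperplaneDist_pos {p : ℕ} {lam : ℝ} (hlam : 0 < lam) (n : EuclideanSpace ℝ (Fin p)) :
    0 < hyperplaneDist lam n := Real.sqrt_pos.2 (by positivity)

theorem hyperplaneDist_sq {p : ℕ} (lam : ℝ) (n : EuclideanSpace ℝ (Fin p)) :
    hyperplaneDist lam n ^ 2 = ‖n‖ ^ 2 + lam ^ 2 := Real.sq_sqrt (by positivity)

section NDFHL

variable {d : ℕ} {lam u : ℝ}

theorem integrable_mixtureWeight_norm {p : ℕ} (ν : ℝ) (hlam : 0 < lam) (hu : 0 < u)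
    (n : EuclideanSpace ℝ (Fin p)) : Integrable (mixtureWeight ν u (‖n‖ ^ 2 + lam ^ 2)) := by
  rw [← hyperplaneDist_sq]
  exact integrable_mixtureWeight ν hu (hyperplaneDist_pos hlam n)

theorem ndfhlPDF_eq (hlam : 0 < lam) (hu : 0 < u) (n : EuclideanSpace ℝ (Fin (d - 1))) :
    ndfhlPDF d lam u n = mixtureConst (d / 2) lam u
      * ∫ τ, mixtureWeight (d / 2) u (‖n‖ ^ 2 + lam ^ 2) τ := by
  have hr := hyperplaneDist_pos hlam n
  rw [← hyperplaneDist_sq, integral_mixtureWeight _ hu hr, ndfhlPDF, mixtureConst,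
    Real.div_rpow hu.le hr.le, Real.rpow_neg hr.le]
  ring

theorem ofReal_ndfhlPDF (hlam : 0 < lam) (hu : 0 < u) (n : EuclideanSpace ℝ (Fin (d - 1))) :
    ENNReal.ofReal (ndfhlPDF d lam u n) = ENNReal.ofReal (mixtureConst (d / 2) lam u)
      * ∫⁻ τ, ENNReal.ofReal (mixtureWeight (d / 2) u (‖n‖ ^ 2 + lam ^ 2) τ) := by
  rw [ndfhlPDF_eq hlam hu, ENNReal.ofReal_mul (mixtureConst_pos _ hlam hu).le,
    ofReal_integral_eq_lintegral_ofReal (integrable_mixtureWeight_norm _ hlam hu n)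
      (ae_of_all _ fun τ => (mixtureWeight_pos _ _ _ _).le)]

theorem measurable_ndfhlPDF (hlam : 0 < lam) (hu : 0 < u) : Measurable (ndfhlPDF d lam u) := by
  have : StronglyMeasurable fun n : EuclideanSpace ℝ (Fin (d - 1)) =>
      ∫ τ, mixtureWeight (d / 2) u (‖n‖ ^ 2 + lam ^ 2) τ :=
    StronglyMeasurable.integral_prod_right'
      (f := fun z : EuclideanSpace ℝ (Fin (d - 1)) × ℝ =>
        mixtureWeight (d / 2) u (‖z.1‖ ^ 2 + lam ^ 2) z.2)
      (Continuous.stronglyMeasurable (by fun_prop))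
  rw [funext fun n => ndfhlPDF_eq hlam hu n]
  exact this.measurable.const_mul _

theorem ndfhlPDF_le (hlam : 0 < lam) (hu : 0 < u) (n : EuclideanSpace ℝ (Fin (d - 1))) :
    ndfhlPDF d lam u n ≤ mixtureConst (d / 2) lam u
      * ∫ τ, mixtureWeight (d / 2) u (lam ^ 2) τ := by
  rw [ndfhlPDF_eq hlam hu]
  refine mul_le_mul_of_nonneg_left ?_ (mixtureConst_pos _ hlam hu).le
  refine integral_mono (integrable_mixtureWeight_norm _ hlam hu n)
    (integrable_mixtureWeight _ hu hlam) fun τ => ?_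
  rw [mixtureWeight_add]
  refine mul_le_of_le_one_right (mixtureWeight_pos _ _ _ _).le (Real.exp_le_one_iff.2 ?_)
  have : 0 ≤ u / 2 * Real.exp (-τ) * ‖n‖ ^ 2 := by positivity
  linarith

/-- The mixture components with `τ ∈ (0, 1]` alone give a Gaussian lower bound. -/
theorem le_ndfhlPDF (hlam : 0 < lam) (hu : 0 < u) (n : EuclideanSpace ℝ (Fin (d - 1))) :
    mixtureConst (d / 2) lam u *
      Real.exp (-(u / 2) * (Real.exp 1 + (‖n‖ ^ 2 + lam ^ 2)) - d / 2) ≤ ndfhlPDF d lam u n := by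
  rw [ndfhlPDF_eq hlam hu]
  refine mul_le_mul_of_nonneg_left ?_ (mixtureConst_pos _ hlam hu).le
  have hi := integrable_mixtureWeight_norm (d / 2) hlam hu n
  calc _ = ∫ _ in Set.Ioc (0 : ℝ) 1,
        Real.exp (-(u / 2) * (Real.exp 1 + (‖n‖ ^ 2 + lam ^ 2)) - d / 2) := by simp
    _ ≤ ∫ τ in Set.Ioc (0 : ℝ) 1, mixtureWeight (d / 2) u (‖n‖ ^ 2 + lam ^ 2) τ := by
        refine setIntegral_mono_on (by simp) hi.integrableOn measurableSet_Ioc fun τ hτ => ?_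
        refine Real.exp_le_exp.2 ?_
        have h1 : Real.exp τ ≤ Real.exp 1 := Real.exp_le_exp.2 hτ.2
        have h2 : Real.exp (-τ) ≤ 1 := Real.exp_le_one_iff.2 (by linarith [hτ.1])
        have h3 : (‖n‖ ^ 2 + lam ^ 2) * Real.exp (-τ) ≤ ‖n‖ ^ 2 + lam ^ 2 :=
          mul_le_of_le_one_right (by positivity) h2
        have h4 : u / 2 * (Real.exp τ + (‖n‖ ^ 2 + lam ^ 2) * Real.exp (-τ))
            ≤ u / 2 * (Real.exp 1 + (‖n‖ ^ 2 + lam ^ 2)) := by gcongr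
        have h5 : (d : ℝ) / 2 * τ ≤ d / 2 := mul_le_of_le_one_right (by positivity) hτ.2
        linarith
    _ ≤ _ := setIntegral_le_integral hi (ae_of_all _ fun τ => (mixtureWeight_pos _ _ _ _).le)

theorem ndfhlPDF_pos (hlam : 0 < lam) (hu : 0 < u) (n : EuclideanSpace ℝ (Fin (d - 1))) :
    0 < ndfhlPDF d lam u n :=
  (mul_pos (mixtureConst_pos _ hlam hu) (Real.exp_pos _)).trans_le (le_ndfhlPDF hlam hu n)

theorem le_log_ndfhlPDF (hlam : 0 < lam) (hu : 0 < u) (n : EuclideanSpace ℝ (Fin (d - 1))) :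
    Real.log (mixtureConst (d / 2) lam u) - u / 2 * (Real.exp 1 + lam ^ 2) - d / 2
      - u / 2 * ‖n‖ ^ 2 ≤ Real.log (ndfhlPDF d lam u n) := by
  have hA := mixtureConst_pos (d / 2) hlam hu
  have := Real.log_le_log (mul_pos hA (Real.exp_pos _)) (le_ndfhlPDF hlam hu n)
  rw [Real.log_mul hA.ne' (Real.exp_ne_zero _), Real.log_exp] at this
  linarith

theorem mixtureConst_mul_eq_one (ν : ℝ) (hlam : 0 < lam) (hu : 0 < u) :
    mixtureConst ν lam u * ((Real.pi / (u / 2)) ^ (ν - 1 / 2)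
      * (2 * besselK (1 / 2) (u * lam) * lam ^ (-(1 / 2) : ℝ))) = 1 := by
  have hpi := Real.pi_pos
  rw [besselK_one_half, mixtureConst, Real.rpow_sub two_pos,
    Real.rpow_sub (show 0 < Real.pi / (u / 2) by positivity), Real.rpow_one,
    Real.rpow_neg hlam.le, ← Real.sqrt_eq_rpow,
    ← Real.sqrt_eq_rpow, Real.div_rpow hpi.le (by positivity), Real.div_rpow hu.le two_pos.le,
    Real.sqrt_div hpi.le, Real.sqrt_div hpi.le, Real.sqrt_div hu.le, Real.sqrt_mul two_pos.le,
    Real.sqrt_mul hu.le, Real.exp_neg, mul_comm lam u]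
  have h2 : (√2) ^ 2 = 2 := Real.sq_sqrt two_pos.le
  have hl : (√lam) ^ 2 = lam := Real.sq_sqrt hlam.le
  field_simp
  rw [h2, hl]
  ring

theorem isProbabilityMeasure_ndfhl (hd : 1 ≤ d) (hlam : 0 < lam) (hu : 0 < u) :
    IsProbabilityMeasure (ndfhl d lam u) := by
  refine ⟨?_⟩
  have hA := mixtureConst_pos (d / 2) hlam hu
  rw [ndfhl, withDensity_apply _ MeasurableSet.univ, Measure.restrict_univ]
  simp only [ofReal_ndfhlPDF hlam hu]
  rw [lintegral_const_mul' _ _ ENNReal.ofReal_ne_top,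
    lintegral_lintegral_swap
      (Continuous.measurable (by fun_prop)).ennreal_ofReal.aemeasurable]
  simp only [mixtureWeight_add, lintegral_mixtureWeight_mul_exp _ _ _ _ (half_pos hu)]
  have hν : (d : ℝ) / 2 - ((d - 1 : ℕ) : ℝ) / 2 = 1 / 2 := by
    rw [Nat.cast_sub hd]
    push_cast
    ring
  have hp : ((d - 1 : ℕ) : ℝ) / 2 = d / 2 - 1 / 2 := by linarith
  rw [hν, hp, ← ofReal_integral_eq_lintegral_ofReal
      ((integrable_mixtureWeight _ hu hlam).const_mul _)
      (ae_of_all _ fun τ => mul_nonneg (by positivity) (mixtureWeight_pos _ _ _ _).le),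
    integral_const_mul, integral_mixtureWeight _ hu hlam, ← ENNReal.ofReal_mul hA.le,
    mixtureConst_mul_eq_one _ hlam hu, ENNReal.ofReal_one]

/-- `‖n‖²` is absorbed by half of the Gaussian exponent, at the price of a factor `(4 / u) e^τ`. -/
theorem sq_mul_mixtureWeight_le (ν s τ x : ℝ) (hu : 0 < u) :
    x * mixtureWeight ν u (x + s) τ ≤
      4 / u * (mixtureWeight (ν - 1) u s τ * Real.exp (-(u / 4 * Real.exp (-τ)) * x)) := by
  have h1 := Real.add_one_le_exp (u / 4 * Real.exp (-τ) * x)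
  have h2 : x ≤ 4 / u * Real.exp τ * Real.exp (u / 4 * Real.exp (-τ) * x) := by
    calc x = 4 / u * Real.exp τ * (u / 4 * Real.exp (-τ) * x) := by
          rw [Real.exp_neg]
          field_simp
      _ ≤ _ := by gcongr; linarith
  calc x * mixtureWeight ν u (x + s) τ
      ≤ 4 / u * Real.exp τ * Real.exp (u / 4 * Real.exp (-τ) * x) * mixtureWeight ν u (x + s) τ :=
        mul_le_mul_of_nonneg_right h2 (mixtureWeight_pos _ _ _ _).le
    _ = _ := by
        rw [mixtureWeight_add]
        unfold mixtureWeight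
        simp only [mul_assoc, ← Real.exp_add]
        ring_nf

theorem integrable_norm_sq_ndfhl (hlam : 0 < lam) (hu : 0 < u) :
    Integrable (fun n => ‖n‖ ^ 2) (ndfhl d lam u) := by
  have hm := measurable_ndfhlPDF (d := d) hlam hu
  refine ⟨by fun_prop, ?_⟩
  rw [hasFiniteIntegral_iff_ofReal (ae_of_all _ fun n => by positivity), ndfhl,
    lintegral_withDensity_eq_lintegral_mul _ (by fun_prop) (by fun_prop)]
  simp only [Pi.mul_apply, ofReal_ndfhlPDF hlam hu, mul_assoc]
  rw [lintegral_const_mul' _ _ ENNReal.ofReal_ne_top]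
  refine ENNReal.mul_lt_top ENNReal.ofReal_lt_top ?_
  have hi := integrable_mixtureWeight ((d : ℝ) / 2 - 1 - ((d - 1 : ℕ) : ℝ) / 2) hu hlam
  calc _ = ∫⁻ n : EuclideanSpace ℝ (Fin (d - 1)), ∫⁻ τ,
        ENNReal.ofReal (‖n‖ ^ 2 * mixtureWeight (d / 2) u (‖n‖ ^ 2 + lam ^ 2) τ) := by
        refine lintegral_congr fun n => ?_
        simp only [ENNReal.ofReal_mul (sq_nonneg ‖n‖)]
        rw [lintegral_const_mul' _ _ ENNReal.ofReal_ne_top, mul_comm]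
    _ ≤ ∫⁻ n : EuclideanSpace ℝ (Fin (d - 1)), ∫⁻ τ,
        ENNReal.ofReal (4 / u) * ENNReal.ofReal (mixtureWeight (d / 2 - 1) u (lam ^ 2) τ
          * Real.exp (-(u / 4 * Real.exp (-τ)) * ‖n‖ ^ 2)) := by
        refine lintegral_mono fun n => lintegral_mono fun τ => ?_
        rw [← ENNReal.ofReal_mul (by positivity)]
        exact ENNReal.ofReal_le_ofReal (sq_mul_mixtureWeight_le _ _ _ _ hu)
    _ = ∫⁻ τ, ENNReal.ofReal (4 / u) * ENNReal.ofReal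
          ((Real.pi / (u / 4)) ^ (((d - 1 : ℕ) : ℝ) / 2)
            * mixtureWeight (d / 2 - 1 - ((d - 1 : ℕ) : ℝ) / 2) u (lam ^ 2) τ) := by
        rw [lintegral_lintegral_swap (Measurable.aemeasurable (by
          refine Measurable.const_mul (Measurable.ennreal_ofReal ?_) _
          exact Continuous.measurable (by fun_prop)))]
        refine lintegral_congr fun τ => ?_
        rw [lintegral_const_mul' _ _ ENNReal.ofReal_ne_top,
          lintegral_mixtureWeight_mul_exp _ _ _ _ (by positivity)]
    _ < ∞ := by
        rw [lintegral_const_mul' _ _ ENNReal.ofReal_ne_top]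
        exact ENNReal.mul_lt_top ENNReal.ofReal_lt_top (hi.const_mul _).lintegral_lt_top

end NDFHL

/-! ### The capacity of the channel -/

theorem mainTheorem2 (d : ℕ) (hd : 2 ≤ d) (lam u : ℝ) (hlam : 0 < lam) (hu : 0 < u) :
    IsProbabilityMeasure (ndfhl d lam u) ∧
    (∀ᶠ P : ℝ in atTop, channelCapacity (ndfhl d lam u) P ≠ ∞) ∧
    (fun P : ℝ => (channelCapacity (ndfhl d lam u) P).toReal
        - ((d - 1 : ℕ) : ℝ) / 2 * Real.log P) =O[atTop] (fun _ => (1 : ℝ)) ∧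
    Tendsto (fun P : ℝ => (channelCapacity (ndfhl d lam u) P).toReal / Real.log P) atTop
      (𝓝 (((d - 1 : ℕ) : ℝ) / 2)) := by
  have hprob := isProbabilityMeasure_ndfhl (le_of_lt hd) hlam hu
  have hint := integrable_norm_sq_ndfhl (d := d) hlam hu
  have hm := measurable_ndfhlPDF (d := d) hlam hu
  have hprob' : IsProbabilityMeasure (volume.withDensity fun n =>
    ENNReal.ofReal (ndfhlPDF d lam u n)) := hprob
  obtain ⟨c₂, hc₂⟩ : ∃ c : ℝ, ∀ P : ℝ, 1 ≤ P → channelCapacity (ndfhl d lam u) P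
      ≤ ENNReal.ofReal (((d - 1 : ℕ) : ℝ) / 2 * Real.log P + c) :=
    ⟨_, fun P hP => channelCapacity_le hm (ndfhlPDF_pos hlam hu) (ndfhlPDF_le hlam hu) hint hP⟩
  obtain ⟨c₁, hc₁⟩ : ∃ c : ℝ, ∀ P : ℝ, 1 ≤ P →
      ENNReal.ofReal (((d - 1 : ℕ) : ℝ) / 2 * Real.log P + c)
        ≤ channelCapacity (ndfhl d lam u) P :=
    ⟨_, fun P hP => le_channelCapacity hm (ndfhlPDF_pos hlam hu) (ndfhlPDF_le hlam hu) hint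
      (le_log_ndfhlPDF hlam hu) (by linarith)⟩
  have hfin : ∀ P : ℝ, 1 ≤ P → channelCapacity (ndfhl d lam u) P ≠ ∞ := fun P hP =>
    ((hc₂ P hP).trans_lt ENNReal.ofReal_lt_top).ne
  have hO : (fun P : ℝ => (channelCapacity (ndfhl d lam u) P).toReal
      - ((d - 1 : ℕ) : ℝ) / 2 * Real.log P) =O[atTop] (fun _ => (1 : ℝ)) := by
    refine IsBigO.of_bound (|c₁| + |c₂|) ?_
    filter_upwards [eventually_ge_atTop 1] with P hP
    have hlog : 0 ≤ ((d - 1 : ℕ) : ℝ) / 2 * Real.log P :=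
      mul_nonneg (by positivity) (Real.log_nonneg hP)
    have h1 : ((d - 1 : ℕ) : ℝ) / 2 * Real.log P + c₁
        ≤ (channelCapacity (ndfhl d lam u) P).toReal :=
      (ENNReal.ofReal_le_iff_le_toReal (hfin P hP)).1 (hc₁ P hP)
    -- `|c₂|` instead of `c₂` keeps the bound nonnegative, so that `ofReal` does not truncate it.
    have h2 : (channelCapacity (ndfhl d lam u) P).toReal
        ≤ ((d - 1 : ℕ) : ℝ) / 2 * Real.log P + |c₂| :=
      ENNReal.toReal_le_of_le_ofReal (by positivity)
        ((hc₂ P hP).trans (ENNReal.ofReal_le_ofReal (by gcongr; exact le_abs_self _)))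
    rw [norm_one, mul_one, Real.norm_eq_abs, abs_le]
    constructor
    · linarith [neg_abs_le c₁, abs_nonneg c₂]
    · linarith [abs_nonneg c₁]
  refine ⟨hprob, ?_, hO, ?_⟩
  · filter_upwards [eventually_ge_atTop 1] with P hP using hfin P hP
  · have h0 : Tendsto (fun P : ℝ => ((channelCapacity (ndfhl d lam u) P).toReal
        - ((d - 1 : ℕ) : ℝ) / 2 * Real.log P) / Real.log P) atTop (𝓝 0) :=
      (hO.trans_isLittleO (isLittleO_const_left.2
        (Or.inr (tendsto_norm_atTop_atTop.comp Real.tendsto_log_atTop)))).tendsto_div_nhds_zero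
    have h1 := h0.add_const (((d - 1 : ℕ) : ℝ) / 2)
    rw [zero_add] at h1
    refine h1.congr' ?_
    filter_upwards [eventually_gt_atTop 1] with P hP
    have := (Real.log_pos hP).ne'
    field_simp
    ring
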